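/- Let $m\ge 1$ and let $\sigma:\mathbb R\to\mathbb R$ be a generalized sigmoidal function of class $C^m$: $\sigma\in C^m(\mathbb R)$, $\sigma$ is strictly increasing on $(-\infty,0]$, and $\lim_{x\to-\infty}\sigma(x)=0$. For a partition $\Delta$: $0=x_0<x_1<\dots<x_\zeta=1$ with subintervals $I_1=[x_0,x_1]$ and $I_j=(x_{j-1},x_j]$ for $2\le j\le\zeta$, let $\mathfrak S_1^m(\Delta)$ be the set of functions $s$ on $[0,1]$ that agree on each $I_i$ with a polynomial $s_i$ of degree at most $m$, where $s_i^{(\mu)}(x_i)=s_{i+1}^{(\mu)}(x_i)$ for $0\le\mu\le m-1$ and $1\le i\le\zeta-1$. A two-layer network with $\Theta$ units has the output $g(x)=\sum_{i=1}^{\Theta}\lambda_i\phi_i(x)$ with $\phi_i(x)=\sigma(w_ix+b_i)$. Then every spline can be approximated in $L^2([0,1])$ with arbitrary precision by such networks, the number of units being any $\Theta\ge\zeta+m$, provided that the $\zeta$ subintervals on which the spline is represented are sufficiently small. Precisely: for every spline $s$ (that is, $s\in\mathfrak S_1^m(\Delta_0)$ for some $\Delta_0$) and every $\varepsilon>0$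 there is $\delta>0$ such that for every partition $\Delta$ with $s\in\mathfrak S_1^m(\Delta)$ all of whose subintervals have length less than $\delta$, $\zeta$ being the number of these subintervals, for every $\Theta\ge\zeta+m$ and every $\eta>0$, there is a two-layer network with $\Theta$ units and with all $w_i>0$, in which $\zeta-1$ distinct units $u_1,\dots,u_{\zeta-1}$ (local units) are attached to the knots $x_1,\dots,x_{\zeta-1}$ and the remaining $\Theta-\zeta+1\ge m+1$ units are called global, such that (i) $\lVert s-g\rVert_{L^2([0,1])}<\varepsilon$; (ii) the partial output $g_0$ of the global units alone realizes the first polynomial piece: $\lVert s-g_0\rVert_{L^2([0,x_1])}<\eta$; (iii) each local unit is negligible on the left of its knot: if $\phi_{(j)}$ and $\lambda_{(j)}$ are the activation and the output weight of $u_j$, then $|\phi_{(j)}(x)|<\varepsilon$ for all $x\le x_j$ and all $j$, and $\sum_{j=1}^{\zeta-1}\lVert\lambda_{(j)}\phi_{(j)}\rVert_{L^2([0,x_j])}<\varepsilon$. In particular $\Theta=\zeta+m$ units suffice: $m+1$ global ones and one local unit for each knot. -/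

import Mathlib

open Set Filter Topology MeasureTheory
open scoped ENNReal

noncomputable section

namespace SplineNet

/-- A generalized sigmoidal function of class `C^k`, `k ≥ 1`: it is increasing on `(-∞, 0]` and
tends to `0` at `-∞`. No condition is imposed at `+∞`. -/
structure IsGeneralizedSigmoidal (k : ℕ) (σ : ℝ → ℝ) : Prop where
  one_le : 1 ≤ k
  contDiff : ContDiff ℝ k σ
  strictMonoOn : StrictMonoOn σ (Iic 0)
  tendsto_atBot : Tendsto σ atBot (𝓝 0)

/-- A partition `0 = x_0 < x_1 < ⋯ < x_ζ = 1` of `[0, 1]` into `ζ` subintervals. -/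
structure KnotPartition (ζ : ℕ) where
  x : Fin (ζ + 1) → ℝ
  x_zero : x 0 = 0
  x_last : x (Fin.last ζ) = 1
  strictMono : StrictMono x

/-- The subintervals `I_1 = [x_0, x_1]` and `I_j = (x_{j-1}, x_j]` for `j ≥ 2`
(numbered from `0` here). -/
def KnotPartition.subinterval {ζ : ℕ} (Δ : KnotPartition ζ) (i : Fin ζ) : Set ℝ :=
  if i.val = 0 then Icc (Δ.x i.castSucc) (Δ.x i.succ) else Ioc (Δ.x i.castSucc) (Δ.x i.succ)

/-- The `ζ - 1` knots `x_1, …, x_{ζ-1}` (numbered from `0` here). -/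
def KnotPartition.knot {ζ : ℕ} (Δ : KnotPartition ζ) (j : Fin (ζ - 1)) : ℝ :=
  Δ.x ⟨j.val + 1, by omega⟩

/-- All subintervals are shorter than `δ`. -/
def KnotPartition.MeshLT {ζ : ℕ} (Δ : KnotPartition ζ) (δ : ℝ) : Prop :=
  ∀ i : Fin ζ, Δ.x i.succ - Δ.x i.castSucc < δ

/-- The space of smooth splines of order `m`: on each subinterval a polynomial of degree at most
`m`, the derivatives of orders `0, …, m - 1` of consecutive polynomials agreeing at their common
knot. Only the values of `s` on `[0, 1]` matter. -/
def splineSpace (m : ℕ) {ζ : ℕ} (Δ : KnotPartition ζ) : Set (ℝ → ℝ) :=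
  {s | ∃ p : Fin ζ → Polynomial ℝ,
    (∀ i, (p i).natDegree ≤ m) ∧
    (∀ i, ∀ x ∈ Δ.subinterval i, s x = (p i).eval x) ∧
    (∀ i j : Fin ζ, j.val = i.val + 1 → ∀ μ < m,
      (Polynomial.derivative^[μ] (p i)).eval (Δ.x i.succ)
        = (Polynomial.derivative^[μ] (p j)).eval (Δ.x i.succ))}

/-- The parameters of a two-layer network with one input, `Θ` hidden units and a linear output. -/
structure TwoLayerNet (Θ : ℕ) where
  weight : Fin Θ → ℝ
  bias : Fin Θ → ℝ
  outWeight : Fin Θ → ℝ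

/-- The activation `φ_i(x) = σ(w_i x + b_i)` of the `i`-th hidden unit. -/
def TwoLayerNet.unit {Θ : ℕ} (N : TwoLayerNet Θ) (σ : ℝ → ℝ) (i : Fin Θ) (x : ℝ) : ℝ :=
  σ (N.weight i * x + N.bias i)

/-- The output `∑ λ_i φ_i(x)` of the network. -/
def TwoLayerNet.output {Θ : ℕ} (N : TwoLayerNet Θ) (σ : ℝ → ℝ) (x : ℝ) : ℝ :=
  ∑ i, N.outWeight i * N.unit σ i x

/-- The part of the output that comes from the units outside a family `loc` of units. -/
def TwoLayerNet.outputOff {Θ n : ℕ} (N : TwoLayerNet Θ) (σ : ℝ → ℝ) (loc : Fin n ↪ Fin Θ)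
    (x : ℝ) : ℝ :=
  ∑ i with ∀ j, loc j ≠ i, N.outWeight i * N.unit σ i x

/-- The `L²` norm of `f` over `[a, b]`. -/
def l2Norm (a b : ℝ) (f : ℝ → ℝ) : ℝ≥0∞ :=
  eLpNorm f 2 (volume.restrict (Icc a b))

end SplineNet

end

/-! Let `p` be the first polynomial piece of `s`. The global units produce `p`, the local units
produce `s - p`, and all of them are used only at arguments `t ≤ R`, where `|σ| < ε`. Global units:
far to the left there is a point at which no derivative of `σ` up to order `m` vanishes, since
otherwise `σ` would be a polynomial tending to `0` at `-∞`. Dilations around that point with `m + 1`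
scales reproduce any polynomial of degree at most `m` up to the Taylor remainder
(`exists_dilations_near_polynomial`). Local units: units evaluated only at `t ≤ R` are dense in
`C([0, 1])` (`IsDecaying.unitClosure_eq_top`). Higher degrees are reached although `σ` is only
`C^m`: moving averages gain derivatives, and their units are uniform limits of networks in `σ`.
Hence some number `n` of units, fixed before the partition, approximates `s - p`. A fine mesh offers
at least `n` knots, all of the first `n` close to `0`; the used units go there and the other local
units get output weight zero. Small intervals `[0, x_j]` then offset large output weights. -/

namespace SplineNet

/-! ### Polynomials of degree at most `m` from `m + 1` units -/

/-- The part of the definition of a generalized sigmoidal function that matters for density: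
`k`-fold smoothness, positivity on `(-∞, 0]` and decay at `-∞`. -/
structure IsDecaying (k : ℕ) (σ : ℝ → ℝ) : Prop where
  contDiff : ContDiff ℝ k σ
  pos : ∀ x ≤ 0, 0 < σ x
  tendsto_atBot : Tendsto σ atBot (𝓝 0)

theorem IsGeneralizedSigmoidal.isDecaying {k : ℕ} {σ : ℝ → ℝ} (h : IsGeneralizedSigmoidal k σ) :
    IsDecaying k σ where
  contDiff := h.contDiff
  tendsto_atBot := h.tendsto_atBot
  pos x hx := by
    have h1 : 0 ≤ σ (x - 1) := by
      refine le_of_tendsto h.tendsto_atBot ?_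
      filter_upwards [eventually_le_atBot (x - 1)] with y hy
      exact h.strictMonoOn.monotoneOn (by simp; linarith) (by simp; linarith) hy
    exact h1.trans_lt (h.strictMonoOn (by simp; linarith) hx (by linarith))

theorem exists_derivative_eq (q : Polynomial ℝ) : ∃ Q : Polynomial ℝ, Q.derivative = q := by
  induction q using Polynomial.induction_on' with
  | add p q hp hq =>
    obtain ⟨P, rfl⟩ := hp
    obtain ⟨Q, rfl⟩ := hq
    exact ⟨P + Q, Polynomial.derivative_add⟩
  | monomial n a =>
    refine ⟨Polynomial.monomial (n + 1) (a / (n + 1)), ?_⟩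
    rw [Polynomial.derivative_monomial]
    have : (n : ℝ) + 1 ≠ 0 := by positivity
    simp [this]

/-- A function whose `k`-th derivative vanishes on a half-line is a polynomial there. -/
theorem exists_polynomial_of_iteratedDeriv_eq_zero (k : ℕ) {f : ℝ → ℝ} {a : ℝ}
    (hf : ContDiff ℝ k f) (h : ∀ x < a, iteratedDeriv k f x = 0) :
    ∃ q : Polynomial ℝ, ∀ x < a, f x = q.eval x := by
  induction k generalizing f with
  | zero => exact ⟨0, fun x hx => by simpa using h x hx⟩
  | succ k ih =>
    have hf' : ContDiff ℝ (k + 1 : ℕ) f := hf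
    rw [Nat.cast_succ, contDiff_succ_iff_deriv] at hf
    obtain ⟨q, hq⟩ := ih hf.2.2 (fun x hx => by rw [← iteratedDeriv_succ']; exact h x hx)
    obtain ⟨Q, rfl⟩ := exists_derivative_eq q
    refine ⟨Q + Polynomial.C (f (a - 1) - Q.eval (a - 1)), fun x hx => ?_⟩
    refine isOpen_Iio.eqOn_of_deriv_eq (𝕜 := ℝ) (s := Iio a) (x := a - 1) isPreconnected_Iio
      hf.1.differentiableOn (Polynomial.differentiable _).differentiableOn
      (fun y hy => ?_) (by simp) (by simp) hx
    rw [hq y hy, Polynomial.deriv]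
    simp

/-- Otherwise `σ` is a polynomial to the left of `a`; its limit `0` at `-∞` makes that polynomial
zero, against positivity. -/
theorem IsDecaying.exists_iteratedDeriv_ne_zero {k : ℕ} {σ : ℝ → ℝ} (h : IsDecaying k σ) (a : ℝ) :
    ∃ x < a, iteratedDeriv k σ x ≠ 0 := by
  by_contra! hc
  obtain ⟨q, hq⟩ := exists_polynomial_of_iteratedDeriv_eq_zero k h.contDiff hc
  have ht : Tendsto (fun x => (q.comp (-Polynomial.X)).eval x) atTop (𝓝 0) := by
    refine (h.tendsto_atBot.comp tendsto_neg_atTop_atBot).congr' ?_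
    filter_upwards [eventually_gt_atTop (-a)] with x hx
    simp [hq (-x) (by linarith)]
  rw [Polynomial.tendsto_nhds_iff, Polynomial.leadingCoeff_eq_zero] at ht
  have hm : min a 0 - 1 < a := by linarith [min_le_left a 0]
  have hp := h.pos (min a 0 - 1) (by linarith [min_le_right a 0])
  rw [hq _ hm] at hp
  have h0 := congrArg (Polynomial.eval (-(min a 0 - 1))) ht.1
  simp only [Polynomial.eval_comp, Polynomial.eval_neg, Polynomial.eval_X, neg_neg,
    Polynomial.eval_zero] at h0
  exact hp.ne' h0

/-- A point far to the left at which no derivative of order at most `k` vanishes. -/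
theorem IsDecaying.exists_forall_iteratedDeriv_ne_zero {k : ℕ} {σ : ℝ → ℝ} (h : IsDecaying k σ)
    (a : ℝ) : ∃ x < a, ∀ l ≤ k, iteratedDeriv l σ x ≠ 0 := by
  -- Induction downwards from order `k`, shrinking an open set: if the derivative of order `l`
  -- vanished throughout `U`, so would the one of order `l + 1`.
  have key : ∀ j ≤ k, ∃ U : Set ℝ, IsOpen U ∧ U.Nonempty ∧ U ⊆ Iio a ∧
      ∀ x ∈ U, ∀ l ≤ k, k - j ≤ l → iteratedDeriv l σ x ≠ 0 := by
    intro j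
    induction j with
    | zero =>
      intro _
      obtain ⟨x, hx, hx'⟩ := h.exists_iteratedDeriv_ne_zero a
      have hc : Continuous (iteratedDeriv k σ) := h.contDiff.continuous_iteratedDeriv k le_rfl
      refine ⟨Iio a ∩ {y | iteratedDeriv k σ y ≠ 0},
        isOpen_Iio.inter (isOpen_ne_fun hc continuous_const), ⟨x, hx, hx'⟩, inter_subset_left, ?_⟩
      rintro y ⟨_, hy⟩ l hl hl'
      obtain rfl : l = k := by omega
      exact hy
    | succ j ih =>
      intro hj
      obtain ⟨U, hU, hne, hUa, hUd⟩ := ih (by omega)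
      set l := k - (j + 1) with hl
      have hc : Continuous (iteratedDeriv l σ) :=
        h.contDiff.continuous_iteratedDeriv l (by exact_mod_cast Nat.sub_le _ _)
      obtain ⟨x, hxU, hx⟩ : ∃ x ∈ U, iteratedDeriv l σ x ≠ 0 := by
        by_contra! hz
        obtain ⟨x, hx⟩ := hne
        refine hUd x hx (l + 1) (by omega) (by omega) ?_
        rw [iteratedDeriv_succ]
        have : iteratedDeriv l σ =ᶠ[𝓝 x] fun _ => 0 := by
          filter_upwards [hU.mem_nhds hx] with y hy using hz y hy
        simpa using this.deriv_eq
      refine ⟨U ∩ {y | iteratedDeriv l σ y ≠ 0},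
        hU.inter (isOpen_ne_fun hc continuous_const), ⟨x, hxU, hx⟩,
        inter_subset_left.trans hUa, ?_⟩
      rintro y ⟨hy, hy'⟩ i hi hi'
      rcases hi'.eq_or_lt with rfl | hlt
      · exact hy'
      · exact hUd y hy i hi (by omega)
  obtain ⟨U, _, ⟨x, hx⟩, hUa, hUd⟩ := key k le_rfl
  exact ⟨x, hUa hx, fun l hl => hUd x hx l hl (by omega)⟩

/-- Dual basis of the moment functionals: weights `y k` with `∑ i, y k i * (i + 1) ^ l = δ_{kl}`. -/
theorem exists_dual_moments (m : ℕ) : ∃ y : Fin (m + 1) → Fin (m + 1) → ℝ,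
    ∀ k l : Fin (m + 1), ∑ i, y k i * ((i : ℝ) + 1) ^ (l : ℕ) = if k = l then 1 else 0 := by
  set V := Matrix.vandermonde (fun i : Fin (m + 1) => (i : ℝ) + 1)
  have hV : IsUnit V.det := by
    rw [isUnit_iff_ne_zero, Matrix.det_vandermonde_ne_zero_iff]
    intro i j hij
    simpa [Fin.ext_iff] using hij
  refine ⟨fun k i => V⁻¹ k i, fun k l => ?_⟩
  have := congrFun (congrFun (Matrix.nonsing_inv_mul V hV) k) l
  rw [Matrix.mul_apply, Matrix.one_apply] at this
  exact this

/-- A function with nonvanishing derivatives of orders up to `m` at `b` generates, by `m + 1`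
dilations around `b`, every polynomial of degree at most `m`. -/
theorem exists_dilations_near_polynomial {m : ℕ} {σ : ℝ → ℝ} (hσ : ContDiff ℝ m σ) {b : ℝ}
    (hb : ∀ l ≤ m, iteratedDeriv l σ b ≠ 0) (p : Polynomial ℝ) (hp : p.natDegree ≤ m)
    {ε : ℝ} (hε : 0 < ε) :
    ∃ (w c : Fin (m + 1) → ℝ), (∀ i, 0 < w i) ∧ (∀ i, w i ≤ 1) ∧
      ∀ x ∈ Icc (0 : ℝ) 1, |p.eval x - ∑ i, c i * σ (w i * x + b)| < ε := by
  obtain ⟨y, hy⟩ := exists_dual_moments m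
  set d : ℕ → ℝ := fun l => ((l.factorial : ℝ))⁻¹ * iteratedDeriv l σ b with hd
  have hd0 : ∀ l ≤ m, d l ≠ 0 := fun l hl =>
    mul_ne_zero (inv_ne_zero (by positivity)) (hb l hl)
  set r : ℝ → ℝ := fun t => σ (b + t) - ∑ l : Fin (m + 1), d l * t ^ (l : ℕ) with hr
  have hro : r =o[𝓝 0] fun t => t ^ m := by
    have h1 := taylor_isLittleO_univ (x₀ := b) hσ
    have h2 : Tendsto (fun t : ℝ => b + t) (𝓝 0) (𝓝 b) := by
      have : Continuous fun t : ℝ => b + t := by fun_prop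
      simpa using this.tendsto 0
    refine (h1.comp_tendsto h2).congr (fun t => ?_) (fun t => by simp)
    simp only [Function.comp, hr, hd, taylor_within_apply, Finset.sum_range, smul_eq_mul,
      iteratedDerivWithin_univ]
    congr 1
    refine Finset.sum_congr rfl fun l _ => ?_
    rw [add_sub_cancel_left]
    ring
  set B : Fin (m + 1) → ℝ := fun i => ∑ k : Fin (m + 1), |y k i| * |p.coeff k / d k| with hB
  set C : ℝ := ∑ i : Fin (m + 1), B i * ((i : ℝ) + 1) ^ m with hC
  have hB0 : ∀ i, 0 ≤ B i := fun i => Finset.sum_nonneg fun k _ => by positivity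
  have hC0 : 0 ≤ C := Finset.sum_nonneg fun i _ => mul_nonneg (hB0 i) (by positivity)
  -- The total error will be at most `ε' * C`; the `+ 1` covers `C = 0`.
  set ε' := ε / (C + 1) with hε'
  have hε'0 : 0 < ε' := by positivity
  obtain ⟨ρ, hρ, hρr⟩ := Metric.eventually_nhds_iff.1 (hro.def hε'0)
  -- The first bound keeps every weight `h * (i + 1)` at most `1`; the second keeps the arguments
  -- strictly inside the radius `ρ` of the Taylor estimate.
  set h : ℝ := min (1 / (m + 1)) (ρ / (2 * (m + 1))) with hh
  have hm1 : (0 : ℝ) < m + 1 := by positivity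
  have hh0 : 0 < h := lt_min (by positivity) (by positivity)
  have hh1 : h * (m + 1) ≤ 1 := by
    have := min_le_left (1 / ((m : ℝ) + 1)) (ρ / (2 * (m + 1)))
    rwa [← hh, le_div_iff₀ hm1] at this
  have hhρ : h * (m + 1) < ρ := by
    have := min_le_right (1 / ((m : ℝ) + 1)) (ρ / (2 * (m + 1)))
    rw [← hh, le_div_iff₀ (by positivity)] at this
    linarith
  have hh1' : h ≤ 1 := by nlinarith [(Nat.cast_nonneg m : (0 : ℝ) ≤ m)]
  have hi : ∀ i : Fin (m + 1), (i : ℝ) + 1 ≤ m + 1 := fun i => by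
    have : (i : ℕ) ≤ m := by omega
    have : ((i : ℕ) : ℝ) ≤ m := by exact_mod_cast this
    linarith
  -- The dual weights isolate the `k`-th Taylor term, and the quotient rescales it to `p.coeff k * x
  -- ^ k`. The price is a growth of order `h ^ (-m)`, which the `o(t ^ m)` remainder absorbs.
  set c : Fin (m + 1) → ℝ := fun i => ∑ k : Fin (m + 1), y k i * (p.coeff k / d k / h ^ (k : ℕ))
    with hc
  have hcB : ∀ i, |c i| * h ^ m ≤ B i := fun i => by
    calc |c i| * h ^ m
        ≤ (∑ k : Fin (m + 1), |y k i * (p.coeff k / d k / h ^ (k : ℕ))|) * h ^ m := by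
          gcongr; exact Finset.abs_sum_le_sum_abs _ _
      _ = ∑ k : Fin (m + 1), |y k i| * |p.coeff k / d k| * (h ^ m / h ^ (k : ℕ)) := by
          rw [Finset.sum_mul]
          refine Finset.sum_congr rfl fun k _ => ?_
          rw [abs_mul, abs_div (p.coeff k / d k), abs_of_pos (pow_pos hh0 _)]
          ring
      _ ≤ B i := by
          refine Finset.sum_le_sum fun k _ => ?_
          refine mul_le_of_le_one_right (by positivity) ?_
          rw [div_le_one (by positivity)]
          exact pow_le_pow_of_le_one hh0.le hh1' (by omega)
  refine ⟨fun i => h * ((i : ℝ) + 1), c, fun i => by positivity, fun i => ?_, fun x hx => ?_⟩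
  · exact (mul_le_mul_of_nonneg_left (hi i) hh0.le).trans hh1
  have hpol : ∑ i, c i * ∑ l : Fin (m + 1), d l * (h * ((i : ℝ) + 1) * x) ^ (l : ℕ) = p.eval x := by
    rw [Polynomial.eval_eq_sum_range' (Nat.lt_succ_of_le hp), Finset.sum_range]
    simp_rw [hc, Finset.mul_sum, Finset.sum_mul]
    rw [Finset.sum_comm]
    refine Finset.sum_congr rfl fun l _ => ?_
    rw [Finset.sum_comm]
    have : ∀ k : Fin (m + 1), ∑ i : Fin (m + 1), y k i * (p.coeff k / d k / h ^ (k : ℕ)) *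
        (d l * (h * ((i : ℝ) + 1) * x) ^ (l : ℕ)) =
        (p.coeff k / d k / h ^ (k : ℕ)) * d l * h ^ (l : ℕ) * x ^ (l : ℕ) *
          (if k = l then 1 else 0) := by
      intro k
      rw [← hy k l, Finset.mul_sum]
      refine Finset.sum_congr rfl fun i _ => ?_
      rw [mul_pow, mul_pow]
      ring
    simp_rw [this]
    simp only [mul_ite, mul_one, mul_zero, Finset.sum_ite_eq', Finset.mem_univ, if_true]
    have := hd0 l (by omega)
    field_simp
  have herr : p.eval x - ∑ i, c i * σ (h * ((i : ℝ) + 1) * x + b) =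
      -∑ i, c i * r (h * ((i : ℝ) + 1) * x) := by
    rw [← hpol, ← Finset.sum_sub_distrib, ← Finset.sum_neg_distrib]
    refine Finset.sum_congr rfl fun i _ => ?_
    rw [hr]
    simp only [add_comm b]
    ring
  rw [herr, abs_neg]
  have hterm : ∀ i : Fin (m + 1), |c i * r (h * ((i : ℝ) + 1) * x)| ≤
      ε' * (B i * ((i : ℝ) + 1) ^ m) := fun i => by
    have h0 : 0 ≤ h * ((i : ℝ) + 1) * x := mul_nonneg (by positivity) hx.1
    have h1 : h * ((i : ℝ) + 1) * x ≤ h * ((i : ℝ) + 1) :=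
      mul_le_of_le_one_right (by positivity) hx.2
    have h2 : h * ((i : ℝ) + 1) ≤ h * (m + 1) := mul_le_mul_of_nonneg_left (hi i) hh0.le
    have h3 := hρr (y := h * ((i : ℝ) + 1) * x) (by
      rw [Real.dist_eq, sub_zero, abs_of_nonneg h0]; linarith)
    rw [Real.norm_eq_abs, Real.norm_eq_abs, abs_of_nonneg (pow_nonneg h0 m)] at h3
    calc |c i * r (h * ((i : ℝ) + 1) * x)|
        ≤ |c i| * (ε' * (h * ((i : ℝ) + 1)) ^ m) := by
          rw [abs_mul]
          gcongr
          exact h3.trans (by gcongr)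
      _ = ε' * ((|c i| * h ^ m) * ((i : ℝ) + 1) ^ m) := by rw [mul_pow]; ring
      _ ≤ _ := by gcongr; exact hcB i
  calc |∑ i, c i * r (h * ((i : ℝ) + 1) * x)|
      ≤ ∑ i, |c i * r (h * ((i : ℝ) + 1) * x)| := Finset.abs_sum_le_sum_abs _ _
    _ ≤ ∑ i : Fin (m + 1), ε' * (B i * ((i : ℝ) + 1) ^ m) := Finset.sum_le_sum fun i _ => hterm i
    _ = ε' * C := by rw [← Finset.mul_sum]
    _ < ε := by
        rw [hε', div_mul_eq_mul_div, div_lt_iff₀ (by positivity)]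
        nlinarith

/-- Every polynomial of degree at most `m` is uniformly approximated on `[0, 1]` by `m + 1` units
with positive weights, evaluated only far to the left. -/
theorem IsDecaying.exists_units_near_polynomial {m : ℕ} {σ : ℝ → ℝ} (hσ : IsDecaying m σ) (R : ℝ)
    (p : Polynomial ℝ) (hp : p.natDegree ≤ m) {ε : ℝ} (hε : 0 < ε) :
    ∃ (w b c : Fin (m + 1) → ℝ), (∀ i, 0 < w i) ∧ (∀ i, w i + b i ≤ R) ∧
      ∀ x ∈ Icc (0 : ℝ) 1, |p.eval x - ∑ i, c i * σ (w i * x + b i)| < ε := by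
  -- With `b < R - 1` and `w i ≤ 1`, the arguments stay below `R`.
  obtain ⟨b, hbR, hb⟩ := hσ.exists_forall_iteratedDeriv_ne_zero (R - 1)
  obtain ⟨w, c, hw, hw1, hx⟩ := exists_dilations_near_polynomial hσ.contDiff hb p hp hε
  exact ⟨w, fun _ => b, c, hw, fun i => by linarith [hw1 i], hx⟩

end SplineNet

/-! ### Density of the far-left units in `C([0, 1])` -/

noncomputable section

namespace SplineNet

/-- The moving average of `σ` over the window `[t - 1, t]`. -/
def movingAverage (σ : ℝ → ℝ) (t : ℝ) : ℝ :=
  ∫ u in (0 : ℝ)..1, σ (t - u)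

theorem movingAverage_eq (σ : ℝ → ℝ) (hσ : Continuous σ) (t : ℝ) :
    movingAverage σ t = (∫ u in (0 : ℝ)..t, σ u) - ∫ u in (0 : ℝ)..(t - 1), σ u := by
  rw [movingAverage, intervalIntegral.integral_comp_sub_left (fun u => σ u), sub_zero,
    intervalIntegral.integral_interval_sub_left] <;> exact hσ.intervalIntegrable _ _

theorem contDiff_movingAverage {k : ℕ} {σ : ℝ → ℝ} (hσ : ContDiff ℝ k σ) :
    ContDiff ℝ (k + 1 : ℕ) (movingAverage σ) := by
  have hF : ContDiff ℝ (k + 1 : ℕ) fun t => ∫ u in (0 : ℝ)..t, σ u := by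
    have hd : ∀ t, HasDerivAt (fun t => ∫ u in (0 : ℝ)..t, σ u) (σ t) t := fun t =>
      hσ.continuous.integral_hasStrictDerivAt 0 t |>.hasDerivAt
    rw [Nat.cast_succ, contDiff_succ_iff_deriv]
    refine ⟨fun t => (hd t).differentiableAt, by simp, ?_⟩
    rwa [show deriv (fun t => ∫ u in (0 : ℝ)..t, σ u) = σ from funext fun t => (hd t).deriv]
  rw [show movingAverage σ = _ from funext (movingAverage_eq σ hσ.continuous)]
  exact hF.sub (hF.comp (contDiff_id.sub contDiff_const))

/-- The window lies to the left of `t`, so positivity on `(-∞, 0]` and decay at `-∞` survive, while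
one derivative is gained. -/
theorem IsDecaying.movingAverage {k : ℕ} {σ : ℝ → ℝ} (hσ : IsDecaying k σ) :
    IsDecaying (k + 1) (movingAverage σ) where
  contDiff := contDiff_movingAverage hσ.contDiff
  pos t ht := by
    have hc := hσ.contDiff.continuous
    refine intervalIntegral.intervalIntegral_pos_of_pos_on
      (Continuous.intervalIntegrable (by fun_prop) _ _) (fun u hu => hσ.pos _ ?_) one_pos
    linarith [hu.1]
  tendsto_atBot := by
    rw [Metric.tendsto_nhds]
    intro ε hε
    have h1 := (Metric.tendsto_nhds.1 hσ.tendsto_atBot) (ε / 2) (by positivity)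
    obtain ⟨T, hT⟩ := eventually_atBot.1 h1
    filter_upwards [eventually_le_atBot T] with t ht
    rw [dist_zero_right]
    have := intervalIntegral.norm_integral_le_of_norm_le_const (a := 0) (b := 1) (C := ε / 2)
      (f := fun u => σ (t - u)) (fun u hu => by
        rw [uIoc_of_le zero_le_one] at hu
        have := hT (t - u) (by linarith [hu.1])
        rw [dist_zero_right] at this
        exact this.le)
    simp only [sub_zero, abs_one, mul_one] at this
    exact this.trans_lt (by linarith)

/-- The unit with activation function `σ`, weight `w` and bias `b` as a continuous function on
`[0, 1]`. -/
def unitMap (σ : C(ℝ, ℝ)) (w b : ℝ) : C(Icc (0 : ℝ) 1, ℝ) :=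
  σ.comp ⟨fun x => w * x + b, by fun_prop⟩

/-- The units with positive weights whose arguments stay below `R` on `[0, 1]`. -/
def leftUnits (σ : C(ℝ, ℝ)) (R : ℝ) : Set C(Icc (0 : ℝ) 1, ℝ) :=
  {f | ∃ w b, 0 < w ∧ w + b ≤ R ∧ f = unitMap σ w b}

/-- The uniform limits of networks built from `leftUnits`. -/
def unitClosure (σ : C(ℝ, ℝ)) (R : ℝ) : Submodule ℝ C(Icc (0 : ℝ) 1, ℝ) :=
  (Submodule.span ℝ (leftUnits σ R)).topologicalClosure

/-- A unit of the average is the mean over `u ∈ (0, 1]` of the units of `σ` with bias `b - u`, which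
still stay below `R`. The mean of a continuous curve in a closed convex set remains in that set. -/
theorem unitClosure_movingAverage_le (σ τ : C(ℝ, ℝ)) (R : ℝ) (hτ : ⇑τ = movingAverage σ) :
    unitClosure τ R ≤ unitClosure σ R := by
  refine Submodule.topologicalClosure_minimal _ (Submodule.span_le.2 ?_)
    (Submodule.isClosed_topologicalClosure _)
  rintro _ ⟨w, b, hw, hb, rfl⟩
  set F : C(ℝ × Icc (0 : ℝ) 1, ℝ) :=
    ⟨fun q => σ (w * q.2 + (b - q.1)), by fun_prop⟩ with hF
  have hFc : Continuous fun u => F.curry u := F.curry.continuous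
  have hint : Integrable (fun u => F.curry u) (volume.restrict (Ioc (0 : ℝ) 1)) :=
    (hFc.integrableOn_Icc (a := 0) (b := 1)).mono_set Ioc_subset_Icc_self
  have : IsProbabilityMeasure (volume.restrict (Ioc (0 : ℝ) 1)) := ⟨by simp⟩
  have hmem : (∫ u in Ioc (0 : ℝ) 1, F.curry u) ∈ unitClosure σ R := by
    refine (unitClosure σ R).convex.integral_mem (Submodule.isClosed_topologicalClosure _)
      ?_ hint
    refine (ae_restrict_iff' measurableSet_Ioc).2 (ae_of_all _ fun u hu => ?_)
    refine Submodule.le_topologicalClosure _ (Submodule.subset_span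
      ⟨w, b - u, hw, by linarith [hu.1], ?_⟩)
    rfl
  suffices he : unitMap τ w b = ∫ u in Ioc (0 : ℝ) 1, F.curry u by
    rw [SetLike.mem_coe, he]; exact hmem
  ext x
  rw [ContinuousMap.integral_apply hint]
  change τ (w * x + b) = _
  rw [hτ, movingAverage, intervalIntegral.integral_of_le zero_le_one]
  refine integral_congr_ae (ae_of_all _ fun u => ?_)
  change σ (w * x + b - u) = σ (w * x + (b - u))
  congr 1
  ring

theorem IsDecaying.toContinuousMapOn_mem_unitClosure {k : ℕ} {σ : C(ℝ, ℝ)} (hσ : IsDecaying k σ)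
    (R : ℝ) (p : Polynomial ℝ) (hp : p.natDegree ≤ k) :
    p.toContinuousMapOn (Icc 0 1) ∈ unitClosure σ R := by
  refine Metric.mem_closure_iff.2 fun ε hε => ?_
  obtain ⟨w, b, c, hw, hwb, h⟩ := hσ.exists_units_near_polynomial R p hp hε
  refine ⟨∑ i, c i • unitMap σ (w i) (b i), Submodule.sum_mem _ fun i _ =>
    Submodule.smul_mem _ _ (Submodule.subset_span ⟨w i, b i, hw i, hwb i, rfl⟩), ?_⟩
  rw [ContinuousMap.dist_lt_iff hε]
  intro x
  rw [Real.dist_eq]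
  simpa [unitMap] using h x x.2

/-- Each averaging raises the admissible degree by one without enlarging the closure. -/
theorem IsDecaying.toContinuousMapOn_mem_unitClosure_of_le {n k : ℕ} {σ : C(ℝ, ℝ)}
    (hσ : IsDecaying k σ) (R : ℝ) (p : Polynomial ℝ) (hp : p.natDegree ≤ k + n) :
    p.toContinuousMapOn (Icc 0 1) ∈ unitClosure σ R := by
  induction n generalizing k σ with
  | zero => exact hσ.toContinuousMapOn_mem_unitClosure R p hp
  | succ n ih =>
    have h := hσ.movingAverage
    exact unitClosure_movingAverage_le σ ⟨_, h.contDiff.continuous⟩ R rfl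
      (ih (σ := ⟨_, h.contDiff.continuous⟩) h (by omega))

/-- **Density**: the units of a decaying activation function, evaluated only far to the left, span
a dense subspace of `C([0, 1])`. -/
theorem IsDecaying.unitClosure_eq_top {k : ℕ} {σ : C(ℝ, ℝ)} (hσ : IsDecaying k σ) (R : ℝ) :
    unitClosure σ R = ⊤ := by
  rw [eq_top_iff]
  intro f _
  have hf : f ∈ (polynomialFunctions (Icc (0 : ℝ) 1)).topologicalClosure := by
    rw [polynomialFunctions_closure_eq_top]; trivial
  refine closure_minimal ?_ (Submodule.isClosed_topologicalClosure _) hf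
  rintro _ ⟨p, -, rfl⟩
  exact hσ.toContinuousMapOn_mem_unitClosure_of_le (n := p.natDegree) R p (by omega)

/-- Universal approximation on `[0, 1]` by units evaluated only far to the left. -/
theorem IsDecaying.exists_units_near {k : ℕ} {σ : ℝ → ℝ} (hσ : IsDecaying k σ) (R : ℝ)
    {f : ℝ → ℝ} (hf : ContinuousOn f (Icc 0 1)) {ε : ℝ} (hε : 0 < ε) :
    ∃ (n : ℕ) (w b c : Fin n → ℝ), (∀ i, 0 < w i) ∧ (∀ i, w i + b i ≤ R) ∧
      ∀ x ∈ Icc (0 : ℝ) 1, |f x - ∑ i, c i * σ (w i * x + b i)| < ε := by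
  set τ : C(ℝ, ℝ) := ⟨σ, hσ.contDiff.continuous⟩
  set g : C(Icc (0 : ℝ) 1, ℝ) := ⟨fun x => f x, hf.domRestrict⟩
  have hg : g ∈ unitClosure τ R := by
    rw [IsDecaying.unitClosure_eq_top (σ := τ) hσ R]; trivial
  obtain ⟨v, hv, hgv⟩ := Metric.mem_closure_iff.1 hg ε hε
  obtain ⟨n, c, u, rfl⟩ := Submodule.mem_span_set'.1 hv
  choose w b hw hb hu using fun i => (u i).2
  refine ⟨n, w, b, c, hw, hb, fun x hx => ?_⟩
  have h := (ContinuousMap.dist_lt_iff hε).1 hgv ⟨x, hx⟩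
  rw [Real.dist_eq] at h
  simp only [hu, ContinuousMap.sum_apply, ContinuousMap.smul_apply, smul_eq_mul] at h
  exact h

end SplineNet
end

/-! ### Norm bounds, splines and assembly of networks -/

noncomputable section

namespace SplineNet

theorem l2Norm_le_of_abs_le {a C : ℝ} {f : ℝ → ℝ} (h : ∀ x ∈ Icc 0 a, |f x| ≤ C) :
    l2Norm 0 a f ≤ ENNReal.ofReal (√a * C) := by
  rw [l2Norm, ENNReal.ofReal_mul (Real.sqrt_nonneg a)]
  refine (eLpNorm_le_of_ae_bound (C := C) ?_).trans_eq ?_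
  · exact (ae_restrict_iff' measurableSet_Icc).2 (ae_of_all _ h)
  · rw [Measure.restrict_apply_univ, Real.volume_Icc, sub_zero, Real.sqrt_eq_rpow]
    rcases le_total 0 a with ha | ha
    · rw [ENNReal.ofReal_rpow_of_nonneg ha (by norm_num)]
      norm_num
    · rw [ENNReal.ofReal_of_nonpos ha, ← Real.sqrt_eq_rpow, Real.sqrt_eq_zero_of_nonpos ha]
      norm_num

theorem l2Norm_lt_of_abs_le {a C ε : ℝ} {f : ℝ → ℝ} (ha : a ≤ 1) (hC : 0 ≤ C) (hε : C < ε)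
    (h : ∀ x ∈ Icc 0 a, |f x| ≤ C) : l2Norm 0 a f < ENNReal.ofReal ε := by
  refine (l2Norm_le_of_abs_le h).trans_lt ((ENNReal.ofReal_lt_ofReal_iff (hC.trans_lt hε)).2 ?_)
  exact (mul_le_of_le_one_left hC (Real.sqrt_le_one.2 ha)).trans_lt hε

namespace KnotPartition

variable {ζ : ℕ}

theorem pos (Δ : KnotPartition ζ) : 0 < ζ := by
  rcases Nat.eq_zero_or_pos ζ with rfl | h
  · have h0 := Δ.x_zero
    have h1 := Δ.x_last
    rw [show Fin.last 0 = 0 from rfl, h0] at h1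
    exact absurd h1 zero_ne_one
  · exact h

theorem x_mem_Icc (Δ : KnotPartition ζ) (i : Fin (ζ + 1)) : Δ.x i ∈ Icc (0 : ℝ) 1 := by
  rw [← Δ.x_zero, ← Δ.x_last]
  exact ⟨Δ.strictMono.monotone (Fin.zero_le i), Δ.strictMono.monotone (Fin.le_last i)⟩

theorem exists_mem_Icc (Δ : KnotPartition ζ) {t : ℝ} (ht : t ∈ Icc (0 : ℝ) 1) :
    ∃ i : Fin ζ, t ∈ Icc (Δ.x i.castSucc) (Δ.x i.succ) := by
  have key : ∀ j : Fin (ζ + 1), t ≤ Δ.x j →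
      t ≤ 0 ∨ ∃ i : Fin ζ, t ∈ Icc (Δ.x i.castSucc) (Δ.x i.succ) := by
    intro j
    induction j using Fin.induction with
    | zero => rw [Δ.x_zero]; exact Or.inl
    | succ i ih =>
      intro h
      rcases le_total t (Δ.x i.castSucc) with h' | h'
      · exact ih h'
      · exact Or.inr ⟨i, h', h⟩
  rcases key (Fin.last ζ) (by rw [Δ.x_last]; exact ht.2) with h | h
  · obtain rfl : t = 0 := le_antisymm h ht.1
    refine ⟨⟨0, Δ.pos⟩, ?_, (Δ.x_mem_Icc _).1⟩
    exact Δ.x_zero.le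
  · exact h

theorem MeshLT.x_le {δ : ℝ} {Δ : KnotPartition ζ} (h : Δ.MeshLT δ) (i : Fin (ζ + 1)) :
    Δ.x i ≤ i * δ := by
  induction i using Fin.induction with
  | zero => simp [Δ.x_zero]
  | succ i ih =>
    have := h i
    simp only [Fin.val_castSucc] at ih
    simp only [Fin.val_succ]
    push_cast
    linarith

end KnotPartition

theorem continuousOn_of_mem_splineSpace {m ζ : ℕ} (hm : 1 ≤ m) {Δ : KnotPartition ζ} {s : ℝ → ℝ}
    (hs : s ∈ splineSpace m Δ) : ContinuousOn s (Icc 0 1) := by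
  obtain ⟨p, -, hp, hj⟩ := hs
  have hcl : ∀ i : Fin ζ, EqOn s (fun x => (p i).eval x) (Icc (Δ.x i.castSucc) (Δ.x i.succ)) := by
    intro i x hx
    by_cases hi : i.val = 0
    · exact hp i x (by rwa [KnotPartition.subinterval, if_pos hi])
    -- At the excluded left endpoint `s` is given by the preceding piece; matching of order `0`,
    -- available because `1 ≤ m`, closes the gap.
    rcases hx.1.eq_or_lt with rfl | hlt
    · set j : Fin ζ := ⟨i.val - 1, by omega⟩ with hjdef
      have hji : j.succ = i.castSucc := Fin.ext (by simp [hjdef]; omega)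
      have hmem : Δ.x j.succ ∈ Δ.subinterval j := by
        have hlt : Δ.x j.castSucc < Δ.x j.succ := Δ.strictMono Fin.castSucc_lt_succ
        unfold KnotPartition.subinterval
        split_ifs
        · exact right_mem_Icc.2 hlt.le
        · exact right_mem_Ioc.2 hlt
      have h1 := hp j _ hmem
      have h2 := hj j i (by simp [hjdef]; omega) 0 hm
      simp only [Function.iterate_zero, id] at h2
      rw [h2, hji] at h1
      exact h1
    · exact hp i x (by rw [KnotPartition.subinterval, if_neg hi]; exact ⟨hlt, hx.2⟩)
  refine ((locallyFinite_of_finite _).continuousOn_iUnion (fun i : Fin ζ => isClosed_Icc)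
    fun i => ((p i).continuous.continuousOn).congr (hcl i)).mono fun x hx => ?_
  exact mem_iUnion.2 (Δ.exists_mem_Icc hx)

/-- The first polynomial piece of a spline. -/
theorem exists_first_piece {m ζ : ℕ} {Δ : KnotPartition ζ} {s : ℝ → ℝ}
    (hs : s ∈ splineSpace m Δ) : ∃ p : Polynomial ℝ, p.natDegree ≤ m ∧
      0 < Δ.x 1 ∧ ∀ x ∈ Icc 0 (Δ.x 1), s x = p.eval x := by
  obtain ⟨p, hd, hp, -⟩ := hs
  obtain ⟨z, rfl⟩ := Nat.exists_eq_succ_of_ne_zero Δ.pos.ne'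
  refine ⟨p 0, hd 0, ?_, fun x hx => hp 0 x ?_⟩
  · rw [← Δ.x_zero]
    exact Δ.strictMono Fin.zero_lt_one
  · rw [KnotPartition.subinterval, if_pos (by simp)]
    simpa [Δ.x_zero] using hx

/-- The first polynomial piece of a spline does not depend on the partition. -/
theorem first_piece_unique {s : ℝ → ℝ} {p q : Polynomial ℝ} {a b : ℝ} (ha : 0 < a) (hb : 0 < b)
    (hp : ∀ x ∈ Icc 0 a, s x = p.eval x) (hq : ∀ x ∈ Icc 0 b, s x = q.eval x) : p = q := by
  refine Polynomial.eq_of_infinite_eval_eq p q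
    ((Icc_infinite (lt_min ha hb)).mono fun x hx => ?_)
  rw [mem_ofPred_eq, ← hp x ⟨hx.1, hx.2.trans (min_le_left _ _)⟩,
    hq x ⟨hx.1, hx.2.trans (min_le_right _ _)⟩]

/-- A family of units can be enlarged by units with output weight zero. -/
theorem exists_padding {n N : ℕ} (hn : n ≤ N) {w b c : Fin n → ℝ} {R : ℝ} (hw : ∀ i, 0 < w i)
    (hb : ∀ i, w i + b i ≤ R) :
    ∃ w' b' c' : Fin N → ℝ, (∀ i, 0 < w' i) ∧ (∀ i, w' i + b' i ≤ R) ∧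
      (∀ i, n ≤ i.val → c' i = 0) ∧
      ∀ F : ℝ → ℝ → ℝ → ℝ, (∀ u v, F u v 0 = 0) →
        ∑ i, F (w' i) (b' i) (c' i) = ∑ i, F (w i) (b i) (c i) := by
  obtain ⟨k, rfl⟩ := Nat.exists_eq_add_of_le hn
  -- Weight `1` and bias `R - 1` meet the bound with equality. The free `F` serves both the output
  -- and the sum of the `|c i|`.
  refine ⟨Fin.append w fun _ => 1, Fin.append b fun _ => R - 1, Fin.append c fun _ => 0,
    fun i => ?_, fun i => ?_, fun i => ?_, fun F hF => ?_⟩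
  · induction i using Fin.addCases with
    | left i => simpa using hw i
    | right i => simp
  · induction i using Fin.addCases with
    | left i => simpa using hb i
    | right i => simp
  · induction i using Fin.addCases with
    | left i => intro h; simp at h; omega
    | right i => simp
  · simp [Fin.sum_univ_add, hF]

/-- The network that puts the units of one family in front of those of another. -/
def TwoLayerNet.append {n k : ℕ} (N : TwoLayerNet n) (M : TwoLayerNet k) :
    TwoLayerNet (n + k) where
  weight := Fin.append N.weight M.weight
  bias := Fin.append N.bias M.bias
  outWeight := Fin.append N.outWeight M.outWeight

theorem TwoLayerNet.unit_append_left {n k : ℕ} (N : TwoLayerNet n) (M : TwoLayerNet k)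
    (σ : ℝ → ℝ) (i : Fin n) : (N.append M).unit σ (Fin.castAdd k i) = N.unit σ i := by
  funext x
  simp [TwoLayerNet.unit, TwoLayerNet.append]

theorem TwoLayerNet.unit_append_right {n k : ℕ} (N : TwoLayerNet n) (M : TwoLayerNet k)
    (σ : ℝ → ℝ) (i : Fin k) : (N.append M).unit σ (Fin.natAdd n i) = M.unit σ i := by
  funext x
  simp [TwoLayerNet.unit, TwoLayerNet.append]

theorem TwoLayerNet.outWeight_append_left {n k : ℕ} (N : TwoLayerNet n) (M : TwoLayerNet k)
    (i : Fin n) : (N.append M).outWeight (Fin.castAdd k i) = N.outWeight i :=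
  Fin.append_left _ _ _

theorem TwoLayerNet.outWeight_append_right {n k : ℕ} (N : TwoLayerNet n) (M : TwoLayerNet k)
    (i : Fin k) : (N.append M).outWeight (Fin.natAdd n i) = M.outWeight i :=
  Fin.append_right _ _ _

theorem TwoLayerNet.output_append {n k : ℕ} (N : TwoLayerNet n) (M : TwoLayerNet k)
    (σ : ℝ → ℝ) (x : ℝ) : (N.append M).output σ x = N.output σ x + M.output σ x := by
  simp only [TwoLayerNet.output, Fin.sum_univ_add, unit_append_left, unit_append_right,
    outWeight_append_left, outWeight_append_right]

theorem TwoLayerNet.outputOff_append {n k : ℕ} (N : TwoLayerNet n) (M : TwoLayerNet k)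
    (σ : ℝ → ℝ) (x : ℝ) :
    (N.append M).outputOff σ (Fin.castAddEmb k) x = M.output σ x := by
  have h (i : Fin k) : ∀ j : Fin n, Fin.castAdd k j ≠ Fin.natAdd n i := fun j h => by
    have := congrArg Fin.val h
    simp at this
    omega
  rw [TwoLayerNet.outputOff, Finset.sum_filter, Fin.sum_univ_add]
  simp [h, TwoLayerNet.output, unit_append_right, outWeight_append_right]

end SplineNet

end

/-! ### The main theorem -/

open SplineNet in
theorem theorem6 (m : ℕ) (σ : ℝ → ℝ) (hσ : SplineNet.IsGeneralizedSigmoidal m σ)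
    (ζ₀ : ℕ) (Δ₀ : SplineNet.KnotPartition ζ₀) (s : ℝ → ℝ) (hs : s ∈ SplineNet.splineSpace m Δ₀)
    (ε : ℝ) (hε : 0 < ε) :
    ∃ δ : ℝ, 0 < δ ∧ ∀ (ζ : ℕ) (Δ : SplineNet.KnotPartition ζ),
      s ∈ SplineNet.splineSpace m Δ → Δ.MeshLT δ →
      ∀ Θ : ℕ, ζ + m ≤ Θ → ∀ η : ℝ, 0 < η →
      ∃ (N : SplineNet.TwoLayerNet Θ) (loc : Fin (ζ - 1) ↪ Fin Θ),
        -- the network is one-sided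
        (∀ i, 0 < N.weight i) ∧
        -- its output approximates the spline on the unit interval
        SplineNet.l2Norm 0 1 (fun x => s x - N.output σ x) < ENNReal.ofReal ε ∧
        -- the units outside `loc` alone realize the first polynomial piece
        SplineNet.l2Norm 0 (Δ.x 1) (fun x => s x - N.outputOff σ loc x) < ENNReal.ofReal η ∧
        -- the unit attached to a knot is negligible on the left of that knot, before the output
        -- weights are applied and after, in the latter case even added up over all knots
        (∀ j, ∀ x ≤ Δ.knot j, |N.unit σ (loc j) x| < ε) ∧
        ∑ j, SplineNet.l2Norm 0 (Δ.knot j)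
          (fun x => N.outWeight (loc j) * N.unit σ (loc j) x) < ENNReal.ofReal ε := by
  have hdec := hσ.isDecaying
  obtain ⟨p, hpm, hx0, hp⟩ := exists_first_piece hs
  obtain ⟨R, hR⟩ : ∃ R, ∀ t ≤ R, |σ t| < ε := by
    have := (Metric.tendsto_nhds.1 hσ.tendsto_atBot) ε hε
    simpa [Real.dist_eq] using eventually_atBot.1 this
  have hf : ContinuousOn (fun x => s x - p.eval x) (Icc 0 1) :=
    (continuousOn_of_mem_splineSpace hσ.one_le hs).sub p.continuous.continuousOn
  obtain ⟨n, w, b, c, hw, hb, hn⟩ :=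
    hdec.exists_units_near R hf (show (0 : ℝ) < ε / 4 by positivity)
  set L : ℝ := ∑ i, |c i| with hL
  have hL0 : 0 ≤ L := Finset.sum_nonneg fun i _ => abs_nonneg _
  -- Two demands: `(n + 1) * δ ≤ 1` forces at least `n` interior knots, and `L * √(n * δ) < 1` tames
  -- the output weights on `[0, n * δ]`.
  set δ : ℝ := 1 / ((n + 1) * (L + 1) ^ 2) with hδdef
  have hδ : 0 < δ := by positivity
  have hδn : (n + 1) * δ ≤ 1 := by
    rw [hδdef, mul_one_div, div_le_one (by positivity)]
    refine le_mul_of_one_le_right (by positivity) ?_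
    nlinarith
  have hδL : L * √(n * δ) < 1 := by
    have h1 : n * δ ≤ (1 / (L + 1)) ^ 2 := by
      rw [hδdef, one_div_pow, mul_one_div, div_le_div_iff₀ (by positivity) (by positivity)]
      nlinarith [sq_nonneg (L + 1)]
    have h2 : √(n * δ) ≤ 1 / (L + 1) :=
      (Real.sqrt_le_sqrt h1).trans_eq (Real.sqrt_sq (by positivity))
    calc L * √(n * δ) ≤ L * (1 / (L + 1)) := by gcongr
      _ < 1 := by rw [mul_one_div, div_lt_one (by positivity)]; linarith
  refine ⟨δ, hδ, fun ζ Δ hsΔ hmesh Θ hΘ η hη => ?_⟩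
  obtain ⟨q, -, hx1, hq⟩ := exists_first_piece hsΔ
  -- The polynomial was taken from `Δ₀` so that `δ` does not depend on `Δ`; it is also the first
  -- piece for `Δ`.
  obtain rfl := first_piece_unique hx0 hx1 hp hq
  have hζ := Δ.pos
  have hnζ : n ≤ ζ - 1 := by
    have h1 := hmesh.x_le (Fin.last ζ)
    rw [Δ.x_last, Fin.val_last] at h1
    have h2 : (n + 1 : ℝ) ≤ ζ := le_of_mul_le_mul_right (hδn.trans h1) hδ
    have h3 : n + 1 ≤ ζ := by exact_mod_cast h2
    omega
  obtain ⟨K, rfl⟩ := Nat.exists_eq_add_of_le (show ζ - 1 ≤ Θ by omega)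
  obtain ⟨wl, bl, cl, hwl, hbl, hcl, hsl⟩ := exists_padding hnζ (c := c) hw hb
  -- `ε / 4` serves the full output, `η / 2` the first piece.
  set κ := min (ε / 4) (η / 2) with hκ
  have hκ0 : 0 < κ := lt_min (by positivity) (by positivity)
  obtain ⟨w₀, b₀, c₀, hw₀, hb₀, hg₀⟩ := hdec.exists_units_near_polynomial R p hpm hκ0
  obtain ⟨wg, bg, cg, hwg, -, -, hsg⟩ :=
    exists_padding (show m + 1 ≤ K by omega) (c := c₀) hw₀ hb₀
  set Nl : TwoLayerNet (ζ - 1) := ⟨wl, bl, cl⟩ with hNl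
  set Ng : TwoLayerNet K := ⟨wg, bg, cg⟩ with hNg
  have hl : ∀ x ∈ Icc (0 : ℝ) 1, |s x - p.eval x - Nl.output σ x| < ε / 4 := fun x hx => by
    have h1 : Nl.output σ x = ∑ i, c i * σ (w i * x + b i) :=
      hsl (fun u v t => t * σ (u * x + v)) (by simp)
    rw [h1]
    exact hn x hx
  have hg : ∀ x ∈ Icc (0 : ℝ) 1, |p.eval x - Ng.output σ x| < κ := fun x hx => by
    have h1 : Ng.output σ x = ∑ i, c₀ i * σ (w₀ i * x + b₀ i) :=
      hsg (fun u v t => t * σ (u * x + v)) (by simp)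
    rw [h1]
    exact hg₀ x hx
  have hsmall : ∀ j, ∀ x ≤ Δ.knot j, |Nl.unit σ j x| < ε := fun j x hx => by
    refine hR _ ?_
    have h1 : x ≤ 1 := hx.trans (Δ.x_mem_Icc _).2
    have h2 : wl j * x ≤ wl j := mul_le_of_le_one_right (hwl j).le h1
    change wl j * x + bl j ≤ R
    linarith [hbl j]
  refine ⟨Nl.append Ng, Fin.castAddEmb K, fun i => ?_, ?_, ?_, fun j x hx => ?_, ?_⟩
  · induction i using Fin.addCases with
    | left i => exact (hwl i).trans_eq (Fin.append_left _ _ _).symm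
    | right i => exact (hwg i).trans_eq (Fin.append_right _ _ _).symm
  · refine l2Norm_lt_of_abs_le le_rfl (C := ε / 2) (by positivity) (by linarith) fun x hx => ?_
    rw [TwoLayerNet.output_append]
    calc |s x - (Nl.output σ x + Ng.output σ x)|
        = |(s x - p.eval x - Nl.output σ x) + (p.eval x - Ng.output σ x)| := by congr 1; ring
      _ ≤ _ := abs_add_le _ _
      _ ≤ ε / 4 + ε / 4 := add_le_add (hl x hx).le ((hg x hx).le.trans (min_le_left _ _))
      _ = ε / 2 := by ring
  · refine l2Norm_lt_of_abs_le (Δ.x_mem_Icc 1).2 hκ0.le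
      ((min_le_right _ _).trans_lt (half_lt_self hη)) fun x hx => ?_
    rw [TwoLayerNet.outputOff_append, hq x hx]
    exact (hg x ⟨hx.1, hx.2.trans (Δ.x_mem_Icc 1).2⟩).le
  · rw [Fin.castAddEmb_apply, TwoLayerNet.unit_append_left]
    exact hsmall j x hx
  · simp only [Fin.castAddEmb_apply, TwoLayerNet.unit_append_left,
      TwoLayerNet.outWeight_append_left]
    have hterm : ∀ j, l2Norm 0 (Δ.knot j) (fun x => Nl.outWeight j * Nl.unit σ j x) ≤
        ENNReal.ofReal (√(n * δ) * (|cl j| * ε)) := fun j => by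
      have hbd : ∀ x ∈ Icc 0 (Δ.knot j), |Nl.outWeight j * Nl.unit σ j x| ≤ |cl j| * ε :=
        fun x hx => by
          rw [abs_mul]
          exact mul_le_mul_of_nonneg_left (hsmall j x hx.2).le (abs_nonneg _)
      refine (l2Norm_le_of_abs_le hbd).trans (ENNReal.ofReal_le_ofReal ?_)
      -- For `j < n` the knot is `x_{j+1}`, hence at most `n * δ`; the remaining units are padding
      -- with output weight zero.
      rcases lt_or_ge j.val n with hj | hj
      · gcongr
        refine (hmesh.x_le _).trans ?_
        gcongr
        exact hj
      · simp [hcl j hj]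
    have hsum : ∑ j, |cl j| = L := hsl (fun _ _ t => |t|) (by simp)
    calc _ ≤ ∑ j, ENNReal.ofReal (√(n * δ) * (|cl j| * ε)) :=
          Finset.sum_le_sum fun j _ => hterm j
      _ = ENNReal.ofReal (L * √(n * δ) * ε) := by
          rw [← ENNReal.ofReal_sum_of_nonneg fun j _ => by positivity, ← Finset.mul_sum,
            ← Finset.sum_mul, hsum]
          ring_nf
      _ < ENNReal.ofReal ε := by
          rw [ENNReal.ofReal_lt_ofReal_iff hε]
          nlinarith
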